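/- Let $K$ be a compact Hausdorff topological group and let $X$ be a complete CAT(0) space of finite flat rank, i.e. there is a bound on the integers $n$ for which the Euclidean space $\mathbb{R}^n$ embeds isometrically into $X$. For an isometry $f$ of $X$ let $|f| = \inf\{d(f(x),x) \mid x\in X\}$ be its translation length, and let $\mathrm{Min}(f)$ be the set of points of $X$ at which this infimum is attained. Call $f$ *semi-simple* if $\mathrm{Min}(f)\neq\emptyset$, and *elliptic* if $|f| = 0$ and $\mathrm{Min}(f)\neq\emptyset$ (equivalently, if $f$ has a fixed point). Let $\varphi\colon K\to \mathrm{Isom}(X)$ be a group homomorphism, not assumed to be continuous, such that $\varphi(k)$ is semi-simple for every $k\in K$. If $\inf\{|\varphi(k)| \mid k\in K,\ |\varphi(k)|>0\}>0$, where $\inf\emptyset=+\infty$, then $\varphi(k)$ is elliptic for every $k\in K$. -/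

import Mathlib

namespace CATZero

/-- `γ`, restricted to `[0, l]`, is a geodesic joining `x` to `y`. The values of `γ` outside
`[0, l]` are irrelevant. -/
structure IsGeodesic {X : Type*} [MetricSpace X] (γ : ℝ → X) (l : ℝ) (x y : X) : Prop where
  length_nonneg : 0 ≤ l
  source : γ 0 = x
  target : γ l = y
  dist_eq : ∀ t ∈ Set.Icc 0 l, ∀ t' ∈ Set.Icc 0 l, dist (γ t) (γ t') = |t - t'|

/-- `S` is a geodesic segment from `x` to `y`: the image of a geodesic joining `x` to `y`. -/
def IsGeodesicSegment {X : Type*} [MetricSpace X] (S : Set X) (x y : X) : Prop :=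
  ∃ (γ : ℝ → X) (l : ℝ), IsGeodesic γ l x y ∧ S = γ '' Set.Icc 0 l

/-- A geodesic space: any two points are joined by a geodesic. -/
def IsGeodesicSpace (X : Type*) [MetricSpace X] : Prop :=
  ∀ x y : X, ∃ (γ : ℝ → X) (l : ℝ), IsGeodesic γ l x y

/-- A geodesic triangle: three vertices and a choice of three geodesic segments, the side `i`
going from the vertex `i` to the vertex `i + 1` (indices modulo `3`). -/
structure GeodesicTriangle (X : Type*) [MetricSpace X] where
  vertex : Fin 3 → X
  side : Fin 3 → Set X
  isGeodesicSegment_side : ∀ i, IsGeodesicSegment (side i) (vertex i) (vertex (i + 1))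

/-- The points `q 0, q 1, q 2` of the Euclidean plane span a comparison triangle for `Δ`. -/
def GeodesicTriangle.IsComparisonTriangle {X : Type*} [MetricSpace X] (Δ : GeodesicTriangle X)
    (q : Fin 3 → EuclideanSpace ℝ (Fin 2)) : Prop :=
  ∀ i j, dist (q i) (q j) = dist (Δ.vertex i) (Δ.vertex j)

/-- `x'` is the comparison point, on the side `i` of the comparison triangle `q`, for the point
`x` of the side `i` of `Δ`. -/
def GeodesicTriangle.IsComparisonPoint {X : Type*} [MetricSpace X] (Δ : GeodesicTriangle X)
    (q : Fin 3 → EuclideanSpace ℝ (Fin 2)) (i : Fin 3) (x : X)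
    (x' : EuclideanSpace ℝ (Fin 2)) : Prop :=
  x ∈ Δ.side i ∧ x' ∈ segment ℝ (q i) (q (i + 1)) ∧ dist x' (q i) = dist x (Δ.vertex i)

/-- The CAT(0) inequality for a geodesic triangle: distances between points of the triangle are
at most the distances between their comparison points. -/
def GeodesicTriangle.SatisfiesCATZeroInequality {X : Type*} [MetricSpace X]
    (Δ : GeodesicTriangle X) : Prop :=
  ∀ q : Fin 3 → EuclideanSpace ℝ (Fin 2), Δ.IsComparisonTriangle q →
    ∀ (i j : Fin 3) (x y : X) (x' y' : EuclideanSpace ℝ (Fin 2)),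
      Δ.IsComparisonPoint q i x x' → Δ.IsComparisonPoint q j y y' → dist x y ≤ dist x' y'

/-- A CAT(0) space: a geodesic space all of whose geodesic triangles satisfy the CAT(0)
inequality. (Completeness is not part of the definition.) -/
structure IsCATZero (X : Type*) [MetricSpace X] : Prop where
  geodesic : IsGeodesicSpace X
  inequality : ∀ Δ : GeodesicTriangle X, Δ.SatisfiesCATZeroInequality

/-- The flat rank: the supremum in `ℕ ∪ {∞}` of all `n` such that `ℝⁿ` with its Euclidean metric
embeds isometrically into `X`. -/
noncomputable def flatRank (X : Type*) [MetricSpace X] : ℕ∞ :=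
  ⨆ (n : ℕ) (_ : ∃ f : EuclideanSpace ℝ (Fin n) → X, Isometry f), (n : ℕ∞)

/-- The translation length `|f| = inf {d(f(x), x) | x ∈ X}`. -/
noncomputable def translationLength {X : Type*} [MetricSpace X] (f : X ≃ᵢ X) : ℝ :=
  ⨅ x : X, dist (f x) x

/-- The minset: the points at which the displacement function attains its infimum. -/
def minset {X : Type*} [MetricSpace X] (f : X ≃ᵢ X) : Set X :=
  {x | dist (f x) x = translationLength f}

/-- An isometry is semi-simple if its minset is non-empty. -/
def IsSemisimple {X : Type*} [MetricSpace X] (f : X ≃ᵢ X) : Prop :=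
  (minset f).Nonempty

/-- An isometry is elliptic if its translation length is zero and its minset is non-empty. -/
def IsElliptic {X : Type*} [MetricSpace X] (f : X ≃ᵢ X) : Prop :=
  translationLength f = 0 ∧ (minset f).Nonempty

/-- The infimum of the non-zero translation lengths of an action by isometries, taken in the
extended reals, so that the infimum of the empty set is `+∞`. -/
noncomputable def infPosTranslationLength {K X : Type*} [Group K] [MetricSpace X]
    (φ : K →* (X ≃ᵢ X)) : EReal :=
  sInf {r : EReal | ∃ k : K, 0 < translationLength (φ k) ∧ r = (translationLength (φ k) : EReal)}

end CATZero

namespace CATZero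

/-! ### Translation lengths in CAT(0) spaces -/

section Geometry

variable {X : Type*} [MetricSpace X]

/-! Semi-simplicity supplies the minsets, so only `|φ k| = 0` is at stake. In a CAT(0) space, `|f ^
2| = 2|f|` and `|f ^ 3| = 3|f|`, and translation length is subadditive on commuting isometries. By
compactness each `c : K` has a commuting `y` such that `w = y ^ 2 * c` is a `3 ^ n`-th power for
every `n`. The gap above `0` then forces `|φ w| = 0`, so `|φ c| = |φ (y ^ 2)| = 2|φ y|`. Positive
lengths could thus be halved forever, against the gap. -/

lemma IsGeodesic.dist_endpoints {γ : ℝ → X} {l : ℝ} {x y : X} (h : IsGeodesic γ l x y) :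
    dist x y = l := by
  have := h.dist_eq 0 ⟨le_rfl, h.length_nonneg⟩ l ⟨h.length_nonneg, le_rfl⟩
  rwa [h.source, h.target, zero_sub, abs_neg, abs_of_nonneg h.length_nonneg] at this

lemma IsGeodesic.comp_isometry {γ : ℝ → X} {l : ℝ} {x y : X} (h : IsGeodesic γ l x y)
    (f : X ≃ᵢ X) : IsGeodesic (f ∘ γ) l (f x) (f y) where
  length_nonneg := h.length_nonneg
  source := by simp [h.source]
  target := by simp [h.target]
  dist_eq t ht t' ht' := (f.dist_eq _ _).trans (h.dist_eq t ht t' ht')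

/-- The Euclidean isosceles triangle with legs of length `a` and base of length `d`; the apex is
the vertex `1`. -/
noncomputable def isoscelesTriangle (a d : ℝ) : Fin 3 → EuclideanSpace ℝ (Fin 2) :=
  ![!₂[-(d / 2), 0], !₂[0, √(a ^ 2 - (d / 2) ^ 2)], !₂[d / 2, 0]]

lemma dist_isoscelesTriangle_zero_one {a d : ℝ} (hd : 0 ≤ d) (h : d ≤ 2 * a) :
    dist (isoscelesTriangle a d 0) (isoscelesTriangle a d 1) = a := by
  have hs : 0 ≤ a ^ 2 - (d / 2) ^ 2 := by nlinarith
  simp only [isoscelesTriangle, EuclideanSpace.dist_eq, Real.dist_eq, sq_abs, Fin.sum_univ_two]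
  simp [Real.sq_sqrt hs, Real.sqrt_sq (by linarith : 0 ≤ a)]

lemma dist_isoscelesTriangle_one_two {a d : ℝ} (hd : 0 ≤ d) (h : d ≤ 2 * a) :
    dist (isoscelesTriangle a d 1) (isoscelesTriangle a d 2) = a := by
  have hs : 0 ≤ a ^ 2 - (d / 2) ^ 2 := by nlinarith
  simp only [isoscelesTriangle, EuclideanSpace.dist_eq, Real.dist_eq, sq_abs, Fin.sum_univ_two]
  simp [Real.sq_sqrt hs, Real.sqrt_sq (by linarith : 0 ≤ a)]

lemma dist_isoscelesTriangle_zero_two {a d : ℝ} (hd : 0 ≤ d) :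
    dist (isoscelesTriangle a d 0) (isoscelesTriangle a d 2) = d := by
  simp only [isoscelesTriangle, EuclideanSpace.dist_eq, Real.dist_eq, sq_abs, Fin.sum_univ_two]
  have : (-(d / 2) - d / 2) ^ 2 = d ^ 2 := by ring
  simp [this, Real.sqrt_sq hd]

/-- The displacement of an isometry at the midpoint of `x` and `f x` is at most half the
displacement of its square at `x`. -/
lemma IsCATZero.exists_dist_le_half (hX : IsCATZero X) (f : X ≃ᵢ X) (x : X) :
    ∃ m : X, dist (f m) m ≤ dist (f (f x)) x / 2 := by
  obtain ⟨γ, l, hγ⟩ := hX.geodesic x (f x)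
  obtain ⟨δ, l', hδ⟩ := hX.geodesic (f (f x)) x
  have hl := hγ.length_nonneg
  have hxl := hγ.dist_endpoints
  have hfxl : dist (f x) (f (f x)) = l := by rw [f.dist_eq, hxl]
  let Δ : GeodesicTriangle X :=
    { vertex := ![x, f x, f (f x)]
      side := ![γ '' Set.Icc 0 l, (f ∘ γ) '' Set.Icc 0 l, δ '' Set.Icc 0 l']
      isGeodesicSegment_side := by
        intro i
        fin_cases i
        exacts [⟨γ, l, hγ, rfl⟩, ⟨f ∘ γ, l, hγ.comp_isometry f, rfl⟩, ⟨δ, l', hδ, rfl⟩] }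
  set d := dist x (f (f x)) with hd
  have hd0 : 0 ≤ d := dist_nonneg
  have hdl : d ≤ 2 * l := by linarith [dist_triangle x (f x) (f (f x))]
  -- Isosceles because `f` carries the side from `x` to `f x` onto the side from `f x` to `f (f x)`.
  set q := isoscelesTriangle l d with hq
  have h01 : dist (q 0) (q 1) = l := dist_isoscelesTriangle_zero_one hd0 hdl
  have h12 : dist (q 1) (q 2) = l := dist_isoscelesTriangle_one_two hd0 hdl
  have h02 : dist (q 0) (q 2) = d := dist_isoscelesTriangle_zero_two hd0
  have hcomp : Δ.IsComparisonTriangle q := by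
    intro i j
    fin_cases i <;> fin_cases j <;>
      simp [Δ, h01, h12, h02, hxl, hfxl, dist_comm (q 1) (q 0), dist_comm (q 2) (q 1),
        dist_comm (q 2) (q 0), dist_comm (f x) x, dist_comm (f (f x)) (f x),
        dist_comm (f (f x)) x, ← hd]
  have hmem : l / 2 ∈ Set.Icc 0 l := ⟨by linarith, by linarith⟩
  have hm : dist (γ (l / 2)) x = l / 2 := by
    have := hγ.dist_eq (l / 2) hmem 0 ⟨le_rfl, hl⟩
    rwa [hγ.source, sub_zero, abs_of_nonneg hmem.1] at this
  have hp : Δ.IsComparisonPoint q 0 (γ (l / 2)) (midpoint ℝ (q 0) (q 1)) := by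
    refine ⟨⟨_, hmem, rfl⟩, midpoint_mem_segment _ _, ?_⟩
    rw [dist_midpoint_left, h01]
    simp only [Δ, Matrix.cons_val_zero, hm, Real.norm_ofNat]
    ring
  have hp' : Δ.IsComparisonPoint q 1 (f (γ (l / 2))) (midpoint ℝ (q 1) (q 2)) := by
    refine ⟨⟨_, hmem, rfl⟩, midpoint_mem_segment _ _, ?_⟩
    rw [dist_midpoint_left, h12]
    simp only [Δ, Matrix.cons_val_one, Matrix.cons_val_zero, f.dist_eq, hm, Real.norm_ofNat]
    ring
  refine ⟨γ (l / 2), ?_⟩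
  have key := hX.inequality Δ q hcomp 1 0 _ _ _ _ hp' hp
  have hmid : dist (midpoint ℝ (q 1) (q 2)) (midpoint ℝ (q 0) (q 1)) = d / 2 := by
    rw [midpoint_comm (q 0) (q 1), ← h02, dist_comm (q 0), dist_eq_norm, dist_eq_norm,
      midpoint_eq_smul_add, midpoint_eq_smul_add, ← smul_sub, add_sub_add_left_eq_sub, norm_smul]
    norm_num
    ring
  rw [hmid] at key
  rwa [dist_comm (f (f x)) x]

lemma translationLength_le_dist (f : X ≃ᵢ X) (x : X) : translationLength f ≤ dist (f x) x :=
  ciInf_le ⟨0, by rintro _ ⟨y, rfl⟩; exact dist_nonneg⟩ x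

lemma translationLength_nonneg (f : X ≃ᵢ X) : 0 ≤ translationLength f :=
  Real.iInf_nonneg fun _ => dist_nonneg

lemma translationLength_inv (f : X ≃ᵢ X) : translationLength f⁻¹ = translationLength f := by
  unfold translationLength
  refine f.symm.toEquiv.iInf_congr fun x => ?_
  change dist (f (f.symm x)) (f.symm x) = dist (f.symm x) x
  rw [f.apply_symm_apply, dist_comm]

lemma dist_pow_apply_le (f : X ≃ᵢ X) (n : ℕ) (x : X) :
    dist ((f ^ n) x) x ≤ n * dist (f x) x := by
  induction n with
  | zero => simp
  | succ n ih =>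
    have h := dist_triangle ((f ^ n) (f x)) ((f ^ n) x) x
    rw [(f ^ n).dist_eq] at h
    rw [pow_succ, IsometryEquiv.mul_apply]
    push_cast
    linarith

/-- Displacements of powers at an arbitrary point grow no faster than at a base point. -/
lemma dist_pow_apply_le_add (f : X ≃ᵢ X) (n : ℕ) (x y : X) :
    dist ((f ^ n) x) x ≤ n * dist (f y) y + 2 * dist x y := by
  have h1 := dist_triangle4 ((f ^ n) x) ((f ^ n) y) y x
  rw [(f ^ n).dist_eq, dist_comm y x] at h1
  linarith [dist_pow_apply_le f n y]

variable [Nonempty X]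

lemma translationLength_pow_le (f : X ≃ᵢ X) (n : ℕ) :
    translationLength (f ^ n) ≤ n * translationLength f := by
  rw [translationLength, translationLength, Real.mul_iInf_of_nonneg n.cast_nonneg]
  exact le_ciInf fun x => (translationLength_le_dist _ x).trans (dist_pow_apply_le f n x)

lemma IsCATZero.translationLength_sq (hX : IsCATZero X) (f : X ≃ᵢ X) :
    translationLength (f ^ 2) = 2 * translationLength f := by
  refine le_antisymm (by exact_mod_cast translationLength_pow_le f 2) (le_ciInf fun x => ?_)
  obtain ⟨m, hm⟩ := hX.exists_dist_le_half f x
  have := translationLength_le_dist f m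
  rw [pow_two, IsometryEquiv.mul_apply]
  linarith

lemma IsCATZero.translationLength_pow_two_pow (hX : IsCATZero X) (f : X ≃ᵢ X) (n : ℕ) :
    translationLength (f ^ 2 ^ n) = 2 ^ n * translationLength f := by
  induction n with
  | zero => simp
  | succ n ih => rw [pow_succ, pow_mul, hX.translationLength_sq, ih]; ring

/-- By commutation, `(f * g) ^ 2 ^ n` moves `y` by at most `2 ^ n * (dist (f x) x + dist (g y) y) +
2 * dist y x`, and by at least `2 ^ n * |f * g|`. Dividing by `2 ^ n` removes the last term, so the
infima over `x` and `y` can be taken separately. -/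
lemma IsCATZero.translationLength_mul_le (hX : IsCATZero X) {f g : X ≃ᵢ X} (h : Commute f g) :
    translationLength (f * g) ≤ translationLength f + translationLength g := by
  have aux : ∀ x y : X, translationLength (f * g) ≤ dist (f x) x + dist (g y) y := by
    intro x y
    by_contra! hlt
    obtain ⟨n, hn⟩ := pow_unbounded_of_one_lt
      (2 * dist y x / (translationLength (f * g) - (dist (f x) x + dist (g y) y)))
      (one_lt_two (α := ℝ))
    rw [div_lt_iff₀ (by linarith)] at hn
    have h1 := translationLength_le_dist ((f * g) ^ 2 ^ n) y
    rw [hX.translationLength_pow_two_pow, h.mul_pow, IsometryEquiv.mul_apply] at h1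
    have h2 := dist_triangle ((f ^ 2 ^ n) ((g ^ 2 ^ n) y)) ((f ^ 2 ^ n) y) y
    rw [(f ^ 2 ^ n).dist_eq] at h2
    have h3 := dist_pow_apply_le_add f (2 ^ n) y x
    have h4 := dist_pow_apply_le g (2 ^ n) y
    push_cast at h3 h4
    linarith
  have aux' : ∀ x : X, translationLength (f * g) - dist (f x) x ≤ translationLength g :=
    fun x => le_ciInf fun y => by linarith [aux x y]
  have : translationLength (f * g) - translationLength g ≤ translationLength f :=
    le_ciInf fun x => by linarith [aux' x]
  linarith

lemma IsCATZero.translationLength_pow_three (hX : IsCATZero X) (f : X ≃ᵢ X) :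
    translationLength (f ^ 3) = 3 * translationLength f := by
  refine le_antisymm (by exact_mod_cast translationLength_pow_le f 3) ?_
  -- Lower bound: `4|f| = |f ^ 4| ≤ |f ^ 3| + |f|`.
  have h4 := hX.translationLength_pow_two_pow f 2
  have h := hX.translationLength_mul_le ((Commute.refl f).pow_left 3)
  rw [← pow_succ] at h
  norm_num at h4 h
  linarith

lemma IsCATZero.translationLength_pow_three_pow (hX : IsCATZero X) (f : X ≃ᵢ X) (n : ℕ) :
    translationLength (f ^ 3 ^ n) = 3 ^ n * translationLength f := by
  induction n with
  | zero => simp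
  | succ n ih => rw [pow_succ, pow_mul, hX.translationLength_pow_three, ih]; ring

end Geometry

/-! ### Divisibility in compact groups -/

section CompactGroup

variable {K : Type*} [Group K]

/-- On the centralizer of `c`, the map `y ↦ y ^ 2 * c` turns `y ↦ y ^ 3 * c` into cubing: `(y ^ 3 *
c) ^ 2 * c = (y ^ 2 * c) ^ 3`. -/
lemma iterate_cube_mul_sq_mul (c : K) (n : ℕ) {u : K} (hu : Commute u c) :
    Commute ((fun y => y ^ 3 * c)^[n] u) c ∧
      ((fun y => y ^ 3 * c)^[n] u) ^ 2 * c = (u ^ 2 * c) ^ 3 ^ n := by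
  induction n with
  | zero => simpa using hu
  | succ n ih =>
    obtain ⟨hc, he⟩ := ih
    rw [Function.iterate_succ_apply']
    set v := (fun y => y ^ 3 * c)^[n] u
    refine ⟨(hc.pow_left 3).mul_left (Commute.refl c), ?_⟩
    rw [pow_succ 3 n, pow_mul, ← he, (hc.pow_left 3).mul_pow, (hc.pow_left 2).mul_pow,
      ← pow_mul, ← pow_mul, mul_assoc, ← pow_succ]

variable [TopologicalSpace K] [IsTopologicalGroup K] [CompactSpace K] [T2Space K]

/-- In a compact group every `c` is, up to a factor that is a `3 ^ n`-th power for all `n`,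
the inverse of a square. -/
lemma exists_commute_forall_sq_mul_eq_pow (c : K) :
    ∃ y : K, Commute y c ∧ ∀ n : ℕ, ∃ u : K, y ^ 2 * c = u ^ 3 ^ n := by
  let T : K → K := fun y => y ^ 3 * c
  let Z : Set K := {y | Commute y c}
  have hT : Continuous T := by fun_prop
  have hZ : IsClosed Z := isClosed_eq (by fun_prop) (by fun_prop)
  have hTZ : ∀ n, Set.MapsTo T^[n] Z Z := fun n u hu => (iterate_cube_mul_sq_mul c n hu).1
  have hcpt : ∀ n, IsCompact (T^[n] '' Z) := fun n => hZ.isCompact.image (hT.iterate n)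
  -- The images `T^[n] '' Z` decrease since `T` preserves `Z`; a point of all of them has an
  -- `n`-fold `T`-preimage in `Z` for each `n`.
  obtain ⟨y, hy⟩ := IsCompact.nonempty_iInter_of_sequence_nonempty_isCompact_isClosed
    (fun n => T^[n] '' Z)
    (fun n => by
      rintro _ ⟨u, hu, rfl⟩
      exact ⟨T u, hTZ 1 hu, (Function.iterate_succ_apply T n u).symm⟩)
    (fun n => ⟨_, 1, Commute.one_left c, rfl⟩) (hcpt 0) (fun n => (hcpt n).isClosed)
  rw [Set.mem_iInter] at hy
  obtain ⟨u, hu, rfl⟩ := hy 0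
  refine ⟨u, hu, fun n => ?_⟩
  obtain ⟨v, hv, hvu⟩ := hy n
  refine ⟨v ^ 2 * c, ?_⟩
  rw [← (iterate_cube_mul_sq_mul c n hv).2]
  exact congrArg (fun z => z ^ 2 * c) hvu.symm

end CompactGroup

/-! ### Halving against the gap -/

lemma exists_pos_le_translationLength {K X : Type*} [Group K] [MetricSpace X]
    {φ : K →* (X ≃ᵢ X)} (h : 0 < infPosTranslationLength φ) :
    ∃ ε : ℝ, 0 < ε ∧ ∀ k, 0 < translationLength (φ k) → ε ≤ translationLength (φ k) := by
  obtain ⟨ε, h0, hε⟩ := EReal.lt_iff_exists_real_btwn.1 h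
  exact ⟨ε, by exact_mod_cast h0, fun k hk => by
    exact_mod_cast hε.le.trans (sInf_le ⟨k, hk, rfl⟩)⟩

/-- A compact group acting on a CAT(0) space with translation lengths bounded away from zero,
where positive, has no positive translation lengths. -/
lemma IsCATZero.translationLength_eq_zero_of_compact
    {K : Type*} [Group K] [TopologicalSpace K] [IsTopologicalGroup K] [CompactSpace K] [T2Space K]
    {X : Type*} [MetricSpace X] [Nonempty X] (hX : IsCATZero X) (φ : K →* (X ≃ᵢ X))
    (hinf : 0 < infPosTranslationLength φ) (k : K) : translationLength (φ k) = 0 := by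
  obtain ⟨ε, hε, hle⟩ := exists_pos_le_translationLength hinf
  have halve : ∀ c : K, ∃ y : K, translationLength (φ c) = 2 * translationLength (φ y) := by
    intro c
    obtain ⟨y, hyc, hy⟩ := exists_commute_forall_sq_mul_eq_pow c
    refine ⟨y, ?_⟩
    have hw : translationLength (φ (y ^ 2 * c)) = 0 := by
      by_contra hne
      have hpos := lt_of_le_of_ne (translationLength_nonneg _) (Ne.symm hne)
      obtain ⟨n, hn⟩ := pow_unbounded_of_one_lt (translationLength (φ (y ^ 2 * c)) / ε)
        (by norm_num : (1 : ℝ) < 3)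
      rw [div_lt_iff₀ hε] at hn
      obtain ⟨u, hu⟩ := hy n
      rw [hu, map_pow, hX.translationLength_pow_three_pow] at hn hpos
      have hun := hle u (pos_of_mul_pos_right hpos (by positivity))
      exact absurd hn (not_lt.2 (by gcongr))
    have hc2 : Commute (φ y ^ 2) (φ c) := (hyc.map φ).pow_left 2
    rw [map_mul, map_pow] at hw
    rw [← hX.translationLength_sq]
    have hcw : Commute (φ y ^ 2 * φ c) (φ c) := hc2.mul_left (Commute.refl _)
    have hyw : Commute (φ y ^ 2) (φ y ^ 2 * φ c) := (Commute.refl _).mul_right hc2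
    -- With `w = y ^ 2 * c` of length zero, use `c = (y ^ 2)⁻¹ * w` and `y ^ 2 = w * c⁻¹`.
    refine le_antisymm ?_ ?_
    · have := hX.translationLength_mul_le hyw.inv_left
      rwa [inv_mul_cancel_left, translationLength_inv, hw, add_zero] at this
    · have := hX.translationLength_mul_le hcw.inv_right
      rwa [mul_inv_cancel_right, translationLength_inv, hw, zero_add] at this
  have grow : ∀ (n : ℕ) (c : K), 0 < translationLength (φ c) →
      2 ^ n * ε ≤ translationLength (φ c) := by
    intro n
    induction n with
    | zero => simpa using hle
    | succ n ih =>
      intro c hc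
      obtain ⟨y, hy⟩ := halve c
      have := ih y (by linarith)
      rw [hy, pow_succ]
      linarith
  by_contra hne
  have hpos := lt_of_le_of_ne (translationLength_nonneg _) (Ne.symm hne)
  obtain ⟨n, hn⟩ := pow_unbounded_of_one_lt (translationLength (φ k) / ε) (one_lt_two (α := ℝ))
  rw [div_lt_iff₀ hε] at hn
  exact absurd (grow n k hpos) (not_le.2 hn)

end CATZero

theorem corollary4p4
    {K : Type*} [Group K] [TopologicalSpace K] [IsTopologicalGroup K] [CompactSpace K] [T2Space K]
    {X : Type*} [MetricSpace X] [CompleteSpace X]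
    (hX : CATZero.IsCATZero X) (hrank : CATZero.flatRank X < ⊤)
    (φ : K →* (X ≃ᵢ X))
    (hss : ∀ k : K, CATZero.IsSemisimple (φ k))
    (hinf : 0 < CATZero.infPosTranslationLength φ) :
    ∀ k : K, CATZero.IsElliptic (φ k) := by
  intro k
  have : Nonempty X := ⟨(hss k).some⟩
  exact ⟨hX.translationLength_eq_zero_of_compact φ hinf k, hss k⟩
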